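/- Let $H$ be a separable infinite-dimensional complex Hilbert space. For a positive compact operator $a$ on $H$ let $\lambda_1(a)\ge\lambda_2(a)\ge\cdots$ be the eigenvalues of $a$ in decreasing order, counted with multiplicity (the positive eigenvalues, followed by zeros if $a$ has finite rank). Let $\alpha:\{0,1,2,\dots\}\to[0,\infty)$ be monotone increasing (in the weak sense) with $\alpha(0)=0$ and $\alpha(1)>0$, and define the non-linear trace of Sugeno type associated with $\alpha$ by $$\psi_\alpha(a)=\sup_{n\ge 1}\,\min\{\lambda_n(a),\alpha(n)\}\in[0,\infty].$$ Then for every positive compact operator $a$ on $H$, $$\psi_\alpha(a)=\max\{\lambda\in[0,\infty)\;:\;\text{there is a finite-rank orthogonal projection } p \text{ on } H \text{ with } \lambda\le\alpha(\dim p)\text{ and } pap\ge\lambda p\},$$ where $\dim p$ is the dimension of the range of $p$; in particular $\psi_\alpha(a)$ is finite and the maximum is attained. -/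

import Mathlib

open scoped NNReal ENNReal

section SugenoTrace

variable {H : Type*} [NormedAddCommGroup H] [InnerProductSpace ℂ H]

/-- The linear span of all eigenvectors of `a` whose eigenvalue is a real number `s ≥ t`.
For a positive operator the eigenspaces are mutually orthogonal, so the dimension of this space
is the number of eigenvalues `≥ t` of `a`, counted with multiplicity. -/
def eigenspaceGE (a : H →L[ℂ] H) (t : ℝ≥0) : Submodule ℂ H :=
  ⨆ s : ℝ≥0, ⨆ _ : t ≤ s, Module.End.eigenspace (a : H →ₗ[ℂ] H) ((s : ℝ) : ℂ)

/-- The eigenvalue sequence `λ₁(a) ≥ λ₂(a) ≥ ⋯` of a positive compact operator `a`: the eigenvalues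
of `a` in decreasing order, counted with multiplicity, followed by zeros if `a` has finite rank.
Its `n`-th term (`n ≥ 1`) is the largest `t > 0` such that at least `n` eigenvalues of `a`, counted
with multiplicity, are `≥ t`, and it is `0` (the supremum of the empty set in `ℝ≥0`) if
`a` has fewer than `n` positive eigenvalues. -/
noncomputable def eigenvalueSeq (a : H →L[ℂ] H) (n : ℕ) : ℝ≥0 :=
  sSup {t : ℝ≥0 | 0 < t ∧ (n : Cardinal) ≤ Module.rank ℂ (eigenspaceGE a t)}

/-- The non-linear trace of Sugeno type associated with `α`,
`ψ_α(a) = ⋁_{n ≥ 1} (λ_n(a) ∧ α(n))`, with values in `[0, ∞]`. -/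
noncomputable def sugenoTrace (α : ℕ → ℝ≥0) (a : H →L[ℂ] H) : ℝ≥0∞ :=
  ⨆ n : ℕ, ⨆ _ : 1 ≤ n, ((eigenvalueSeq a n ⊓ α n : ℝ≥0) : ℝ≥0∞)

end SugenoTrace

section SugenoTrace

variable {H : Type*} [NormedAddCommGroup H] [InnerProductSpace ℂ H]

/-! Write `E_t` for `eigenspaceGE a t`. For `t > 0` it is finite-dimensional, the form `⟨ax, x⟩` is
at least `t‖x‖²` on it and strictly smaller at nonzero vectors of its complement. Hence `dim E_t` is
the largest dimension of a subspace on which the form is at least `t`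
(`finrank_le_finrank_eigenspaceGE`), and for `n ≥ 1`, `t ≤ λ_n` iff `n ≤ dim E_t`.

Since `pap ≥ λp` is this form bound on the range of `p`, an admissible `λ > 0` satisfies `λ ≤
min(λ_n, α n)` with `n = dim p`. Conversely, a positive Sugeno trace `s` is attained at some `n`,
and the projection onto `E_s` is admissible for it. -/

/-! ### Spectral subspaces and the quadratic form -/

theorem eigenspace_le_eigenspaceGE (a : H →L[ℂ] H) {s t : ℝ≥0} (h : t ≤ s) :
    Module.End.eigenspace (a : H →ₗ[ℂ] H) ((s : ℝ) : ℂ) ≤ eigenspaceGE a t :=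
  le_iSup₂ (f := fun (s : ℝ≥0) (_ : t ≤ s) =>
    Module.End.eigenspace (a : H →ₗ[ℂ] H) ((s : ℝ) : ℂ)) s h

theorem eigenspaceGE_antitone (a : H →L[ℂ] H) : Antitone (eigenspaceGE a) := fun _ _ h =>
  iSup₂_le fun _ hs => eigenspace_le_eigenspaceGE a (h.trans hs)

theorem map_mem_eigenspaceGE (a : H →L[ℂ] H) (t : ℝ≥0) {x : H} (hx : x ∈ eigenspaceGE a t) :
    a x ∈ eigenspaceGE a t := by
  suffices h : eigenspaceGE a t ≤ (eigenspaceGE a t).comap (a : H →ₗ[ℂ] H) from h hx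
  refine iSup₂_le fun s hs y hy => eigenspace_le_eigenspaceGE a hs ?_
  have h := Module.End.mem_eigenspace_iff.1 hy
  rw [h]
  exact Submodule.smul_mem _ _ hy

theorem map_mem_orthogonal_eigenspaceGE {a : H →L[ℂ] H} (ha : a.IsPositive) (t : ℝ≥0) {x : H}
    (hx : x ∈ (eigenspaceGE a t)ᗮ) : a x ∈ (eigenspaceGE a t)ᗮ := by
  rw [Submodule.mem_orthogonal] at hx ⊢
  intro u hu
  have h : inner ℂ (a u) x = inner ℂ u (a x) := ha.1 u x
  rw [← h]
  exact hx _ (map_mem_eigenspaceGE a t hu)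

/-- The quadratic form of `a` is at least `t` on the span of the eigenvectors with
eigenvalue at least `t`. -/
theorem le_re_inner_of_mem_eigenspaceGE {a : H →L[ℂ] H} (ha : a.IsPositive) {t : ℝ≥0} {x : H}
    (hx : x ∈ eigenspaceGE a t) : t * ‖x‖ ^ 2 ≤ (inner ℂ (a x) x).re := by
  classical
  have hinj : Function.Injective (fun s : {s : ℝ≥0 // t ≤ s} => (((s : ℝ≥0) : ℝ) : ℂ)) := by
    intro s s' h
    simpa [Subtype.ext_iff] using h
  have hO := ha.1.orthogonalFamily_eigenspaces.comp hinj
  rw [eigenspaceGE, iSup_subtype', Submodule.mem_iSup_iff_exists_finsupp] at hx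
  obtain ⟨f, hf, rfl⟩ := hx
  let l : (s : {s : ℝ≥0 // t ≤ s}) →
      Module.End.eigenspace (a : H →ₗ[ℂ] H) (((s : ℝ≥0) : ℝ) : ℂ) := fun s => ⟨f s, hf s⟩
  have h1 := hO.norm_sum l f.support
  have h2 := hO.inner_sum (fun s => (((s : ℝ≥0) : ℝ) : ℂ) • l s) l f.support
  have h3 : a (f.sum fun _ x => x) =
      ∑ s ∈ f.support, (((s : ℝ≥0) : ℝ) : ℂ) • f s := by
    rw [Finsupp.sum, map_sum]
    exact Finset.sum_congr rfl fun s _ => Module.End.mem_eigenspace_iff.1 (hf s)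
  have h4 : inner ℂ (a (f.sum fun _ x => x)) (f.sum fun _ x => x) =
      ∑ s ∈ f.support, inner ℂ ((((s : ℝ≥0) : ℝ) : ℂ) • l s) (l s) := by
    rw [h3]; exact h2
  have h5 : ‖f.sum fun _ x => x‖ ^ 2 = ∑ s ∈ f.support, ‖l s‖ ^ 2 := h1
  rw [h4, h5, Finset.mul_sum, Complex.re_sum]
  refine Finset.sum_le_sum fun s _ => ?_
  have h6 : (inner ℂ ((((s : ℝ≥0) : ℝ) : ℂ) • l s) (l s)).re = (s : ℝ≥0) * ‖l s‖ ^ 2 := by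
    rw [inner_smul_left, inner_self_eq_norm_sq_to_K]
    rw [Complex.conj_ofReal]
    change (_ * ((‖l s‖ : ℂ)) ^ 2).re = _
    rw [← Complex.ofReal_pow, ← Complex.ofReal_mul, Complex.ofReal_re]
  rw [h6]
  have : (t : ℝ) ≤ ((s : ℝ≥0) : ℝ) := s.2
  gcongr

theorem mul_norm_le_norm_map_of_mem_eigenspaceGE {a : H →L[ℂ] H} (ha : a.IsPositive) {t : ℝ≥0}
    {x : H} (hx : x ∈ eigenspaceGE a t) : t * ‖x‖ ≤ ‖a x‖ := by
  have h := (le_re_inner_of_mem_eigenspaceGE ha hx).trans (re_inner_le_norm (𝕜 := ℂ) (a x) x)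
  rcases (norm_nonneg x).eq_or_lt with h0 | h0
  · simp [← h0]
  · nlinarith

/-- Being bounded below by `t`, `a` embeds the closure of the span as a closed subset; compactness
of `a` then makes the identity of that closure compact. -/
theorem finiteDimensional_eigenspaceGE [CompleteSpace H] {a : H →L[ℂ] H} (hc : IsCompactOperator a)
    (ha : a.IsPositive) {t : ℝ≥0} (ht : 0 < t) : FiniteDimensional ℂ (eigenspaceGE a t) := by
  set V := (eigenspaceGE a t).topologicalClosure
  have hV : CompleteSpace V := (Submodule.isClosed_topologicalClosure _).completeSpace_coe
  have hb : ∀ x ∈ V, t * ‖x‖ ≤ ‖a x‖ := by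
    have hcl : IsClosed {x : H | t * ‖x‖ ≤ ‖a x‖} :=
      isClosed_le (by fun_prop) (by fun_prop)
    exact fun x hx => closure_minimal
      (fun y hy => mul_norm_le_norm_map_of_mem_eigenspaceGE ha hy) hcl hx
  let g : V →L[ℂ] H := a ∘L V.subtypeL
  have hg : IsCompactOperator g := hc.comp_clm V.subtypeL
  have hanti : AntilipschitzWith t⁻¹ g := by
    refine g.antilipschitz_of_bound fun x => ?_
    rw [NNReal.coe_inv, inv_mul_eq_div, le_div_iff₀ (by exact_mod_cast ht), mul_comm]
    exact hb x x.2
  have hemb := hanti.isClosedEmbedding g.uniformContinuous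
  obtain ⟨K, hK, hKg⟩ := hg
  have hid : IsCompactOperator (id : V → V) := ⟨g ⁻¹' K, hemb.isCompact_preimage hK, hKg⟩
  have : FiniteDimensional ℂ V := .of_isCompactOperator_id hid
  exact Submodule.finiteDimensional_of_le (Submodule.le_topologicalClosure _)

/-- A nonzero compact positive operator has its norm as an eigenvalue. -/
theorem hasEigenvalue_norm [CompleteSpace H] {a : H →L[ℂ] H} (hc : IsCompactOperator a)
    (ha : a.IsPositive) (h0 : a ≠ 0) :
    Module.End.HasEigenvalue (a : H →ₗ[ℂ] H) ((‖a‖ : ℝ) : ℂ) := by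
  have : Nontrivial H := by
    by_contra h
    rw [not_nontrivial_iff_subsingleton] at h
    exact h0 (by ext x; exact Subsingleton.elim _ _)
  have hne : ((‖a‖ : ℝ) : ℂ) ≠ 0 := by simpa using h0
  rw [hc.hasEigenvalue_iff_mem_spectrum hne]
  by_contra h
  -- Off the spectrum, Rayleigh quotients stay `ε` below `‖a‖`, yet their supremum is `‖a‖`.
  obtain ⟨ε, hε, hle⟩ := a.rayleighQuotient_le_of_norm_mem_resolventSet (Set.notMem_compl_iff.1 h)
  have h1 := a.norm_eq_iSup_rayleighQuotient ha.1
  have h2 : ⨆ x, |a.rayleighQuotient x| ≤ ‖a‖ - ε := ciSup_le fun x => by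
    rw [abs_of_nonneg (div_nonneg (ha.2 x) (sq_nonneg _))]
    exact hle x
  linarith

/-- The restriction of `a` to the complement has norm below `t`: otherwise that norm would be an
eigenvalue at least `t`, with an eigenvector lying in both the span and its complement. -/
theorem re_inner_lt_of_mem_orthogonal_eigenspaceGE [CompleteSpace H] {a : H →L[ℂ] H}
    (hc : IsCompactOperator a) (ha : a.IsPositive) {t : ℝ≥0} (ht : 0 < t) {x : H}
    (hx : x ∈ (eigenspaceGE a t)ᗮ) (hx0 : x ≠ 0) : (inner ℂ (a x) x).re < t * ‖x‖ ^ 2 := by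
  set M := (eigenspaceGE a t)ᗮ
  have hM : ∀ y ∈ M, a y ∈ M := fun y hy => map_mem_orthogonal_eigenspaceGE ha t hy
  let b : M →L[ℂ] M := a.restrict hM
  have hbc : IsCompactOperator b := hc.restrict' (f := (a : H →ₗ[ℂ] H)) hM
  have hbp : b.IsPositive := ⟨ha.1.restrict_invariant hM, fun y => ha.2 y⟩
  have hlt : ‖b‖ < t := by
    by_contra! hle
    have hb0 : b ≠ 0 := by
      intro h
      have h1 : ‖b‖ = 0 := by rw [h]; exact ContinuousLinearMap.opNorm_zero
      exact absurd (hle.trans_eq h1) (not_le.2 (by exact_mod_cast ht))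
    obtain ⟨v, hv, hv0⟩ := (hasEigenvalue_norm hbc hbp hb0).exists_hasEigenvector
    have h1 : (v : H) ∈ eigenspaceGE a t := by
      refine eigenspace_le_eigenspaceGE a (s := ‖b‖₊) hle ?_
      rw [Module.End.mem_eigenspace_iff] at hv ⊢
      exact congrArg Subtype.val hv
    have h2 := Submodule.disjoint_def.1 (Submodule.orthogonal_disjoint _) _ h1 v.2
    exact hv0 (Subtype.ext h2)
  have h1 : (inner ℂ (a x) x).re ≤ ‖b‖ * ‖x‖ ^ 2 := by
    have h2 := (re_inner_le_norm (𝕜 := ℂ) (a x) x)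
    have h3 : ‖a x‖ ≤ ‖b‖ * ‖x‖ := b.le_opNorm ⟨x, hx⟩
    calc (inner ℂ (a x) x).re ≤ ‖a x‖ * ‖x‖ := h2
      _ ≤ ‖b‖ * ‖x‖ * ‖x‖ := by gcongr
      _ = _ := by ring
  have : 0 < ‖x‖ := norm_pos_iff.2 hx0
  exact h1.trans_lt (by gcongr)

/-- Half of the min-max principle: a subspace on which the quadratic form of `a` is at least `t`
has dimension at most the number of eigenvalues of `a` that are at least `t`. -/
theorem finrank_le_finrank_eigenspaceGE [CompleteSpace H] {a : H →L[ℂ] H}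
    (hc : IsCompactOperator a) (ha : a.IsPositive) {t : ℝ≥0} (ht : 0 < t) (F : Submodule ℂ H)
    (hF : ∀ x ∈ F, t * ‖x‖ ^ 2 ≤ (inner ℂ (a x) x).re) :
    Module.finrank ℂ F ≤ Module.finrank ℂ (eigenspaceGE a t) := by
  have := finiteDimensional_eigenspaceGE hc ha ht
  let P := (eigenspaceGE a t).orthogonalProjectionOnto
  -- A nonzero kernel vector would lie in `F` and in the complement, where the form is below `t`.
  refine LinearMap.finrank_le_finrank_of_injective
    (f := (P : H →ₗ[ℂ] eigenspaceGE a t) ∘ₗ F.subtype) ?_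
  rw [← LinearMap.ker_eq_bot, LinearMap.ker_eq_bot']
  intro x hx
  by_contra h0
  have hx' : (x : H) ∈ (eigenspaceGE a t)ᗮ :=
    Submodule.orthogonalProjectionOnto_eq_zero_iff.1 hx
  exact absurd (hF x x.2) (not_le.2 (re_inner_lt_of_mem_orthogonal_eigenspaceGE hc ha ht hx'
    fun h => h0 (Subtype.ext h)))

/-! ### Eigenvalue sequence and attained suprema -/

theorem natCast_le_rank_eigenspaceGE_iff [CompleteSpace H] {a : H →L[ℂ] H}
    (hc : IsCompactOperator a) (ha : a.IsPositive) {t : ℝ≥0} (ht : 0 < t) (n : ℕ) :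
    (n : Cardinal) ≤ Module.rank ℂ (eigenspaceGE a t) ↔
      n ≤ Module.finrank ℂ (eigenspaceGE a t) := by
  have := finiteDimensional_eigenspaceGE hc ha ht
  rw [← Module.finrank_eq_rank, Nat.cast_le]

theorem bddAbove_eigenvalueSeq_set [CompleteSpace H] {a : H →L[ℂ] H}
    (hc : IsCompactOperator a) (ha : a.IsPositive) {n : ℕ} (hn : 1 ≤ n) :
    BddAbove {t : ℝ≥0 | 0 < t ∧ (n : Cardinal) ≤ Module.rank ℂ (eigenspaceGE a t)} := by
  refine ⟨‖a‖₊, fun t ht => ?_⟩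
  obtain ⟨ht, h⟩ := ht
  rw [natCast_le_rank_eigenspaceGE_iff hc ha ht] at h
  have := finiteDimensional_eigenspaceGE hc ha ht
  have hpos : 0 < Module.finrank ℂ (eigenspaceGE a t) := hn.trans h
  have := Module.finrank_pos_iff.1 hpos
  obtain ⟨x, hx⟩ := exists_ne (0 : eigenspaceGE a t)
  have h1 := (mul_norm_le_norm_map_of_mem_eigenspaceGE ha x.2).trans (a.le_opNorm x)
  exact NNReal.coe_le_coe.1 <| le_of_mul_le_mul_right h1 (norm_pos_iff.2 fun h => hx (Subtype.ext h))

theorem le_eigenvalueSeq [CompleteSpace H] {a : H →L[ℂ] H}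
    (hc : IsCompactOperator a) (ha : a.IsPositive) {n : ℕ} (hn : 1 ≤ n) {t : ℝ≥0} (ht : 0 < t)
    (h : n ≤ Module.finrank ℂ (eigenspaceGE a t)) : t ≤ eigenvalueSeq a n :=
  le_csSup (bddAbove_eigenvalueSeq_set hc ha hn)
    ⟨ht, (natCast_le_rank_eigenspaceGE_iff hc ha ht n).2 h⟩

theorem le_finrank_eigenspaceGE_of_lt [CompleteSpace H] {a : H →L[ℂ] H}
    (hc : IsCompactOperator a) (ha : a.IsPositive) {n : ℕ} {t : ℝ≥0}
    (ht : 0 < t) (h : t < eigenvalueSeq a n) : n ≤ Module.finrank ℂ (eigenspaceGE a t) := by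
  obtain ⟨s, ⟨hs, hn⟩, hts⟩ := exists_lt_of_lt_csSup' h
  rw [natCast_le_rank_eigenspaceGE_iff hc ha hs] at hn
  have := finiteDimensional_eigenspaceGE hc ha ht
  exact hn.trans (Submodule.finrank_mono (eigenspaceGE_antitone a hts.le))

/-- The supremum defining a positive `n`-th eigenvalue is attained. -/
theorem le_finrank_eigenspaceGE_eigenvalueSeq [CompleteSpace H] {a : H →L[ℂ] H}
    (hc : IsCompactOperator a) (ha : a.IsPositive) {n : ℕ} (h : 0 < eigenvalueSeq a n) :
    n ≤ Module.finrank ℂ (eigenspaceGE a (eigenvalueSeq a n)) := by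
  set m := eigenvalueSeq a n
  have hne : {t : ℝ≥0 | 0 < t ∧ t < m}.Nonempty := exists_between h
  let d : ℝ≥0 → ℕ := fun t => Module.finrank ℂ (eigenspaceGE a t)
  -- Dimensions are natural numbers, so the decreasing spaces `E_t` stabilise as `t` increases to
  -- `m`; the form bounds then pass to the limit.
  obtain ⟨t₀, ⟨ht₀, htm⟩, hmin⟩ := exists_minimalFor_of_wellFoundedLT
    (fun t : ℝ≥0 => 0 < t ∧ t < m) d hne
  have hconst : ∀ t, t₀ ≤ t → t < m → eigenspaceGE a t = eigenspaceGE a t₀ := by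
    intro t h1 h2
    have := finiteDimensional_eigenspaceGE hc ha ht₀
    have hle := eigenspaceGE_antitone a h1
    refine Submodule.eq_of_le_of_finrank_le hle ?_
    exact hmin ⟨ht₀.trans_le h1, h2⟩ (Submodule.finrank_mono hle)
  refine (le_finrank_eigenspaceGE_of_lt hc ha ht₀ htm).trans
    (finrank_le_finrank_eigenspaceGE hc ha h _ fun x hx => ?_)
  by_contra! hlt
  have hx0 : 0 < ‖x‖ ^ 2 := by
    rcases (sq_nonneg ‖x‖).eq_or_lt with h0 | h0
    · rw [← h0, mul_zero] at hlt
      exact absurd (ha.2 x) (not_le.2 hlt)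
    · exact h0
  rw [← div_lt_iff₀ hx0] at hlt
  have h0 : 0 ≤ (inner ℂ (a x) x).re / ‖x‖ ^ 2 := div_nonneg (ha.2 x) hx0.le
  lift (inner ℂ (a x) x).re / ‖x‖ ^ 2 to ℝ≥0 using h0 with q hq
  obtain ⟨t, h1, h2⟩ := exists_between (max_lt (NNReal.coe_lt_coe.1 hlt) htm)
  rw [max_lt_iff] at h1
  have h3 := le_re_inner_of_mem_eigenspaceGE ha (t := t) (x := x) (by rwa [hconst t h1.2.le h2])
  rw [← le_div_iff₀ hx0, ← hq, NNReal.coe_le_coe] at h3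
  exact absurd h1.1 (not_lt.2 h3)

theorem le_finrank_eigenspaceGE_of_le [CompleteSpace H] {a : H →L[ℂ] H}
    (hc : IsCompactOperator a) (ha : a.IsPositive) {n : ℕ} {t : ℝ≥0}
    (ht : 0 < t) (h : t ≤ eigenvalueSeq a n) : n ≤ Module.finrank ℂ (eigenspaceGE a t) := by
  have := finiteDimensional_eigenspaceGE hc ha ht
  exact (le_finrank_eigenspaceGE_eigenvalueSeq hc ha (ht.trans_le h)).trans
    (Submodule.finrank_mono (eigenspaceGE_antitone a h))

/-- The Sugeno trace is zero or one of the terms of the supremum that defines it. -/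
theorem sugenoTrace_eq_zero_or_exists [CompleteSpace H] {a : H →L[ℂ] H}
    (hc : IsCompactOperator a) (ha : a.IsPositive) (α : ℕ → ℝ≥0) :
    sugenoTrace α a = 0 ∨ ∃ n, 1 ≤ n ∧
      sugenoTrace α a = ((eigenvalueSeq a n ⊓ α n : ℝ≥0) : ℝ≥0∞) := by
  by_cases h : ∀ n, 1 ≤ n → eigenvalueSeq a n ⊓ α n = 0
  · left
    rw [sugenoTrace]
    simp only [ENNReal.iSup_eq_zero]
    exact fun n hn => by rw [h n hn, ENNReal.coe_zero]
  · right
    push Not at h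
    obtain ⟨k, hk, hk0⟩ := h
    set r := eigenvalueSeq a k ⊓ α k
    have hr : 0 < r := pos_iff_ne_zero.2 hk0
    -- Terms of index beyond `N` are at most `r`, the `k`-th term, so a maximum over `1, …, N` is
    -- global.
    let N := Module.finrank ℂ (eigenspaceGE a r)
    have hkN : k ≤ N := le_finrank_eigenspaceGE_of_le hc ha hr inf_le_left
    obtain ⟨n, hn, hmax⟩ := (Finset.Icc 1 N).exists_max_image
      (fun n => eigenvalueSeq a n ⊓ α n) ⟨k, Finset.mem_Icc.2 ⟨hk, hkN⟩⟩
    refine ⟨n, (Finset.mem_Icc.1 hn).1, le_antisymm (iSup₂_le fun j hj => ?_)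
      (le_iSup₂ (f := fun (n : ℕ) (_ : 1 ≤ n) => ((eigenvalueSeq a n ⊓ α n : ℝ≥0) : ℝ≥0∞))
        n (Finset.mem_Icc.1 hn).1)⟩
    rw [ENNReal.coe_le_coe]
    by_cases hjN : j ≤ N
    · exact hmax j (Finset.mem_Icc.2 ⟨hj, hjN⟩)
    · refine le_trans ?_ (hmax k (Finset.mem_Icc.2 ⟨hk, hkN⟩))
      by_contra! hlt
      exact hjN (le_finrank_eigenspaceGE_of_le hc ha hr (hlt.le.trans inf_le_left))

/-! ### Projections and the maximum formula -/

theorem smul_starProjection_le_iff [CompleteSpace H] {a : H →L[ℂ] H} (ha : a.IsPositive)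
    {p : H →L[ℂ] H} (hp : IsStarProjection p) (l : ℝ≥0) :
    ((l : ℝ) : ℂ) • p ≤ p * a * p ↔
      ∀ x ∈ LinearMap.range (p : H →ₗ[ℂ] H), l * ‖x‖ ^ 2 ≤ (inner ℂ (a x) x).re := by
  have hsym : ∀ x y, inner ℂ (p x) y = inner ℂ x (p y) := hp.isSelfAdjoint.isSymmetric
  have hidem : ∀ x, p (p x) = p x := fun x =>
    congrArg (fun q : H →L[ℂ] H => q x) hp.isIdempotentElem
  have key : ∀ x, (p * a * p - ((l : ℝ) : ℂ) • p).reApplyInnerSelf x =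
      (inner ℂ (a (p x)) (p x)).re - l * ‖p x‖ ^ 2 := by
    intro x
    have h1 : inner ℂ (p x) x = ((‖p x‖ ^ 2 : ℝ) : ℂ) := by
      rw [← hidem x, hsym, hidem, inner_self_eq_norm_sq_to_K]
      norm_cast
    have h2 : (p * a * p - ((l : ℝ) : ℂ) • p) x = p (a (p x)) - ((l : ℝ) : ℂ) • p x := rfl
    rw [ContinuousLinearMap.reApplyInnerSelf_apply, h2, inner_sub_left, hsym, inner_smul_left, h1,
      Complex.conj_ofReal, ← Complex.ofReal_mul, map_sub]
    rfl
  rw [ContinuousLinearMap.le_def]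
  constructor
  · rintro ⟨-, h⟩ _ ⟨x, rfl⟩
    have := h x
    rw [key] at this
    exact sub_nonneg.1 this
  · intro h
    refine ⟨?_, fun x => ?_⟩
    · intro x y
      have h1 : ∀ x y, inner ℂ (a x) y = inner ℂ x (a y) := ha.1
      change inner ℂ (p (a (p x)) - ((l : ℝ) : ℂ) • p x) y =
        inner ℂ x (p (a (p y)) - ((l : ℝ) : ℂ) • p y)
      rw [inner_sub_left, inner_sub_right, hsym, h1, hsym, inner_smul_left, inner_smul_right,
        Complex.conj_ofReal, hsym]
    · rw [key]
      exact sub_nonneg.2 (h _ ⟨x, rfl⟩)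

end SugenoTrace

theorem mainTheorem9 {H : Type*} [NormedAddCommGroup H] [InnerProductSpace ℂ H] [CompleteSpace H]
    [TopologicalSpace.SeparableSpace H] (hH : ¬ FiniteDimensional ℂ H)
    (α : ℕ → ℝ≥0) (hα : Monotone α) (hα0 : α 0 = 0) (hα1 : 0 < α 1)
    (a : H →L[ℂ] H) (ha : IsCompactOperator a) (ha0 : 0 ≤ a) :
    IsGreatest
      ((fun l : ℝ≥0 => (l : ℝ≥0∞)) '' {l : ℝ≥0 | ∃ p : H →L[ℂ] H,
        IsStarProjection p ∧ FiniteDimensional ℂ (LinearMap.range (p : H →ₗ[ℂ] H)) ∧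
        l ≤ α (Module.finrank ℂ (LinearMap.range (p : H →ₗ[ℂ] H))) ∧
        ((l : ℝ) : ℂ) • p ≤ p * a * p})
      (sugenoTrace α a) := by
  have hpos : a.IsPositive := (ContinuousLinearMap.nonneg_iff_isPositive a).1 ha0
  constructor
  · have hzero : sugenoTrace α a = 0 ∨ ∃ n, 0 < eigenvalueSeq a n ⊓ α n ∧
        sugenoTrace α a = ((eigenvalueSeq a n ⊓ α n : ℝ≥0) : ℝ≥0∞) := by
      rcases sugenoTrace_eq_zero_or_exists ha hpos α with h | ⟨n, -, h⟩
      · exact .inl h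
      · rcases eq_or_ne (eigenvalueSeq a n ⊓ α n) 0 with h0 | h0
        · exact .inl (by rw [h, h0, ENNReal.coe_zero])
        · exact .inr ⟨n, pos_iff_ne_zero.2 h0, h⟩
    rcases hzero with h | ⟨n, h0, h⟩
    · refine ⟨0, ⟨0, .zero _, ?_, zero_le, by simp⟩, by simp [h]⟩
      rw [ContinuousLinearMap.toLinearMap_zero, LinearMap.range_zero]
      infer_instance
    · set s := eigenvalueSeq a n ⊓ α n
      have := finiteDimensional_eigenspaceGE ha hpos h0
      have hr := Submodule.range_starProjection (eigenspaceGE a s)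
      refine ⟨s, ⟨(eigenspaceGE a s).starProjection, isStarProjection_starProjection, ?_, ?_, ?_⟩,
        h.symm⟩
      · rwa [hr]
      · rw [hr]
        -- `dim E_s` may exceed `n`; monotonicity of `α` absorbs the excess.
        exact inf_le_right.trans (hα (le_finrank_eigenspaceGE_of_le ha hpos h0 inf_le_left))
      · rw [smul_starProjection_le_iff hpos isStarProjection_starProjection, hr]
        exact fun x hx => le_re_inner_of_mem_eigenspaceGE hpos hx
  · rintro _ ⟨l, ⟨p, hp, hfin, hl, hle⟩, rfl⟩
    rcases eq_or_ne l 0 with rfl | hl0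
    · simp
    have hlpos : 0 < l := pos_iff_ne_zero.2 hl0
    set n := Module.finrank ℂ (LinearMap.range (p : H →ₗ[ℂ] H))
    -- The projection `p = 0` satisfies the operator inequality for every `l`; only `α 0 = 0`
    -- excludes it.
    have hn : 1 ≤ n := by
      by_contra! h
      rw [Nat.lt_one_iff.1 h, hα0] at hl
      exact absurd hl (not_le.2 hlpos)
    have h1 := finrank_le_finrank_eigenspaceGE ha hpos hlpos _
      ((smul_starProjection_le_iff hpos hp l).1 hle)
    refine le_trans ?_
      (le_iSup₂ (f := fun (n : ℕ) (_ : 1 ≤ n) => ((eigenvalueSeq a n ⊓ α n : ℝ≥0) : ℝ≥0∞)) n hn)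
    exact ENNReal.coe_le_coe.2 (le_inf (le_eigenvalueSeq ha hpos hn hlpos h1) hl)
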